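/- Let $\mathbb T=\mathbb R/2\pi\mathbb Z$ and let $a\in L^1(\mathbb T)$ be real-valued, with Fourier coefficients $$a_k=\frac1{2\pi}\int_{-\pi}^{\pi}a(t)e^{-ikt}\,dt\qquad(k\in\mathbb Z).$$ For $n\ge 1$ let $T_n(a)=[a_{j-i}]_{i,j=0}^{n-1}$ be the associated $n\times n$ Toeplitz matrix, which is Hermitian, and let $\lambda_1(T_n(a)),\dots,\lambda_n(T_n(a))\in\mathbb R$ be its eigenvalues, counted with multiplicity. Then, for every (real- or complex-valued) continuous function $\varphi$ on $\mathbb R$ with compact support, $$\lim_{n\to\infty}\frac1n\sum_{k=1}^n\varphi\bigl(\lambda_k(T_n(a))\bigr)=\frac1{2\pi}\int_{-\pi}^{\pi}\varphi(a(t))\,dt.$$ -/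

import Mathlib

open MeasureTheory Filter Topology
open scoped Real

instance fact_two_pi_pos : Fact (0 < 2 * π) := ⟨Real.two_pi_pos⟩

/-- The `n × n` Toeplitz matrix `T_n(a)` with symbol `a` on the circle `𝕋 = ℝ / 2πℤ`: its entry in
row `i` and column `j` is the Fourier coefficient
`a_{j-i} = (1/2π) ∫_{-π}^{π} a(t) e^{-i(j-i)t} dt`. -/
noncomputable def toeplitzMatrix (a : AddCircle (2 * π) → ℂ) (n : ℕ) :
    Matrix (Fin n) (Fin n) ℂ :=
  Matrix.of fun i j => fourierCoeff a ((j : ℤ) - (i : ℤ))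

/-- A Toeplitz matrix with real-valued symbol is Hermitian, so that `IsHermitian.eigenvalues` lists
its `n` (real) eigenvalues, with multiplicity. -/
theorem toeplitzMatrix_isHermitian (a : AddCircle (2 * π) → ℝ) (n : ℕ) :
    (toeplitzMatrix (fun t => (a t : ℂ)) n).IsHermitian := by
  ext i j
  simp only [toeplitzMatrix, Matrix.conjTranspose_apply, Matrix.of_apply, fourierCoeff,
    RCLike.star_def]
  rw [← integral_conj]
  congr 1
  funext t
  simp only [smul_eq_mul, map_mul, Complex.conj_ofReal, ← fourier_neg]
  congr 2
  ring_nf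

/-! Everything reduces to the test functions `|x - c|`: for each real `c`, the mean of `|λ_k - c|`
tends to the mean of `|a - c|` (`tendsto_sum_abs_eigenvalues_sub`). Second differences of these are
tents, which approximate every continuous compactly supported function uniformly.

Let `e_s` be the vector of characters at `s` and `v_k` an orthonormal eigenbasis. The weights
`w_k(s) = |⟨e_s, v_k⟩|²` are doubly stochastic up to scale: each has integral 1 over the circle, and
they sum to `n` at each `s`. Since `λ_k` is the `w_k`-average of `a`, the triangle inequality bounds
the mean of `|λ_k - c|` by that of `|a - c|`. Conversely the Fejér mean `σ_n a(t)` is the average of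
the `λ_k` with weights `w_k(t)/n`, so the mean of `|σ_n a - c|` is at most that of `|λ_k - c|`. As
`σ_n a → a` in `L¹`, both bounds meet. -/

/-! ### Quadratic forms of Toeplitz matrices -/

/-- The vector `(e^{ijs})_{0 ≤ j < n}` of characters evaluated at the point `s` of the circle. -/
noncomputable def charVec (n : ℕ) (s : AddCircle (2 * π)) : EuclideanSpace ℂ (Fin n) :=
  WithLp.toLp 2 fun j => fourier (j : ℤ) s

theorem inner_charVec {n : ℕ} (s : AddCircle (2 * π)) (v : EuclideanSpace ℂ (Fin n)) :
    inner ℂ (charVec n s) v = ∑ j : Fin n, v j * fourier (-(j : ℤ)) s := by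
  simp only [charVec, PiLp.inner_apply, RCLike.inner_apply, fourier_neg]

theorem norm_charVec_sq (n : ℕ) (s : AddCircle (2 * π)) : ‖charVec n s‖ ^ 2 = n := by
  simp [charVec, EuclideanSpace.norm_sq_eq, Circle.norm_coe]

theorem continuous_inner_charVec {n : ℕ} (v : EuclideanSpace ℂ (Fin n)) :
    Continuous fun s => inner ℂ (charVec n s) v := by
  simp only [inner_charVec]
  fun_prop

theorem norm_inner_charVec_sq {n : ℕ} (s : AddCircle (2 * π)) (v : EuclideanSpace ℂ (Fin n)) :
    ((‖inner ℂ (charVec n s) v‖ ^ 2 : ℝ) : ℂ) =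
      ∑ i : Fin n, ∑ j : Fin n, (starRingEnd ℂ (v i) * v j) * fourier (-((j : ℤ) - i)) s := by
  rw [← Complex.normSq_eq_norm_sq, Complex.normSq_eq_conj_mul_self, inner_charVec, map_sum, Finset.sum_mul_sum]
  refine Finset.sum_congr rfl fun i _ => Finset.sum_congr rfl fun j _ => ?_
  have : (-((j : ℤ) - i)) = (i : ℤ) + -(j : ℤ) := by ring
  rw [this, fourier_add, map_mul, ← fourier_neg, neg_neg]
  ring

theorem integrable_mul_norm_inner_charVec_sq {n : ℕ} {b : AddCircle (2 * π) → ℝ}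
    (hb : Integrable b AddCircle.haarAddCircle) (v : EuclideanSpace ℂ (Fin n)) :
    Integrable (fun s => b s * ‖inner ℂ (charVec n s) v‖ ^ 2) AddCircle.haarAddCircle := by
  have hc : Continuous fun s => ‖inner ℂ (charVec n s) v‖ ^ 2 :=
    (continuous_inner_charVec v).norm.pow 2
  obtain ⟨C, hC⟩ := isCompact_univ.exists_bound_of_continuousOn hc.continuousOn
  exact hb.mul_bdd hc.aestronglyMeasurable (ae_of_all _ fun s => hC s trivial)

theorem inner_toeplitzMatrix {n : ℕ} {b : AddCircle (2 * π) → ℂ}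
    (hb : Integrable b AddCircle.haarAddCircle) (v : EuclideanSpace ℂ (Fin n)) :
    inner ℂ v (Matrix.toEuclideanLin (toeplitzMatrix b n) v) =
      ∫ s, b s * (‖inner ℂ (charVec n s) v‖ ^ 2 : ℝ) ∂AddCircle.haarAddCircle := by
  have hint (c : ℂ) (k : ℤ) :
      Integrable (fun s => b s * (c * fourier k s)) AddCircle.haarAddCircle := by
    convert! (hb.fourier_smul k).const_mul c using 2 with s
    simp only [smul_eq_mul]
    ring
  simp only [norm_inner_charVec_sq, Finset.mul_sum]
  rw [integral_finsetSum _ fun i _ => integrable_finsetSum _ fun j _ => hint _ _]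
  simp only [PiLp.inner_apply, Matrix.toLpLin_apply, Matrix.mulVec, dotProduct,
    RCLike.inner_apply, Finset.sum_mul]
  refine Finset.sum_congr rfl fun i _ => ?_
  rw [integral_finsetSum _ fun j _ => hint _ _]
  refine Finset.sum_congr rfl fun j _ => ?_
  simp only [toeplitzMatrix, Matrix.of_apply, fourierCoeff, smul_eq_mul]
  rw [mul_assoc, ← integral_mul_const]
  congr 1
  funext s
  ring

theorem toeplitzMatrix_one (n : ℕ) : toeplitzMatrix (fun _ => 1) n = 1 := by
  ext i j
  have : (fun _ : AddCircle (2 * π) => (1 : ℂ)) = fourier 0 := by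
    funext s; simp
  rw [toeplitzMatrix, Matrix.of_apply, this, fourierCoeff_fourier, Matrix.one_apply, Pi.single_apply]
  congr 1
  rw [sub_eq_zero, Nat.cast_inj, Fin.val_inj]
  exact propext eq_comm

/-- The symbol 1 has the identity as its Toeplitz matrix. -/
theorem integral_norm_inner_charVec_sq {n : ℕ} (v : EuclideanSpace ℂ (Fin n)) :
    ∫ s, ‖inner ℂ (charVec n s) v‖ ^ 2 ∂AddCircle.haarAddCircle = ‖v‖ ^ 2 := by
  have h := inner_toeplitzMatrix (integrable_const (1 : ℂ)) v
  simp only [toeplitzMatrix_one, one_mul, integral_complex_ofReal] at h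
  rw [← Complex.ofReal_inj, ← h]
  simp [inner_self_eq_norm_sq_to_K]

/-! ### Eigenvalues as averages of the symbol -/

section Spectral

variable {a : AddCircle (2 * π) → ℝ} {n : ℕ}

theorem toEuclideanLin_eigenvectorBasis {A : Matrix (Fin n) (Fin n) ℂ} (hA : A.IsHermitian)
    (k : Fin n) : Matrix.toEuclideanLin A (hA.eigenvectorBasis k) =
      (hA.eigenvalues k : ℂ) • hA.eigenvectorBasis k := by
  rw [Matrix.toLpLin_apply, hA.mulVec_eigenvectorBasis]
  rfl

theorem inner_toEuclideanLin_eq_sum {A : Matrix (Fin n) (Fin n) ℂ} (hA : A.IsHermitian)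
    (x : EuclideanSpace ℂ (Fin n)) : inner ℂ x (Matrix.toEuclideanLin A x) =
      ((∑ k, hA.eigenvalues k * ‖inner ℂ x (hA.eigenvectorBasis k)‖ ^ 2 : ℝ) : ℂ) := by
  rw [← hA.eigenvectorBasis.sum_inner_mul_inner, Complex.ofReal_sum]
  refine Finset.sum_congr rfl fun k _ => ?_
  have hs := Matrix.isSymmetric_toEuclideanLin_iff.mpr hA
  rw [← hs, toEuclideanLin_eigenvectorBasis, inner_smul_left, Complex.conj_ofReal]
  rw [← inner_conj_symm (hA.eigenvectorBasis k) x, mul_left_comm, Complex.mul_conj,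
    Complex.normSq_eq_norm_sq]
  push_cast
  rfl

theorem eigenvalues_toeplitzMatrix (ha : Integrable a AddCircle.haarAddCircle) (k : Fin n) :
    (toeplitzMatrix_isHermitian a n).eigenvalues k =
      ∫ s, a s * ‖inner ℂ (charVec n s) ((toeplitzMatrix_isHermitian a n).eigenvectorBasis k)‖ ^ 2
        ∂AddCircle.haarAddCircle := by
  have h := inner_toeplitzMatrix (n := n) ha.ofReal
    ((toeplitzMatrix_isHermitian a n).eigenvectorBasis k)
  erw [toEuclideanLin_eigenvectorBasis] at h
  rw [inner_smul_right, inner_self_eq_norm_sq_to_K, OrthonormalBasis.norm_eq_one] at h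
  simp only [Complex.coe_algebraMap, Complex.ofReal_one, one_pow, mul_one] at h
  rw [← Complex.ofReal_inj, h, ← integral_complex_ofReal]
  simp

end Spectral

/-! ### Fejér means and the two `L¹` inequalities -/

/-- The Fejér mean `σ_n b` of an integrable function `b` on the circle. The Fejér kernel
`F_n(t - s)` is written as `‖⟨e_s, e_t⟩‖² / n`, with `e_s` the vector `charVec n s`. -/
noncomputable def fejerMean (n : ℕ) (b : AddCircle (2 * π) → ℂ) (t : AddCircle (2 * π)) : ℂ :=
  (n : ℂ)⁻¹ * ∫ s, b s * (‖inner ℂ (charVec n s) (charVec n t)‖ ^ 2 : ℝ) ∂AddCircle.haarAddCircle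

section Bounds

variable {a : AddCircle (2 * π) → ℝ} {n : ℕ}

/-- Unit mass of each weight lets `c` pass under the integral; Parseval then sums the weights over
`k` to `n`. -/
theorem sum_abs_eigenvalues_sub_le (ha : Integrable a AddCircle.haarAddCircle) (c : ℝ) :
    ∑ k, |(toeplitzMatrix_isHermitian a n).eigenvalues k - c| ≤
      n * ∫ s, |a s - c| ∂AddCircle.haarAddCircle := by
  set v := (toeplitzMatrix_isHermitian a n).eigenvectorBasis
  have hac : Integrable (fun s => a s - c) AddCircle.haarAddCircle := ha.sub (integrable_const c)
  have hk (k : Fin n) : |(toeplitzMatrix_isHermitian a n).eigenvalues k - c| ≤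
      ∫ s, |a s - c| * ‖inner ℂ (charVec n s) (v k)‖ ^ 2 ∂AddCircle.haarAddCircle := by
    have h1 : (toeplitzMatrix_isHermitian a n).eigenvalues k - c =
        ∫ s, (a s - c) * ‖inner ℂ (charVec n s) (v k)‖ ^ 2 ∂AddCircle.haarAddCircle := by
      simp only [sub_mul]
      rw [integral_sub (integrable_mul_norm_inner_charVec_sq ha _)
        (integrable_mul_norm_inner_charVec_sq (integrable_const c) _), integral_const_mul,
        integral_norm_inner_charVec_sq, OrthonormalBasis.norm_eq_one, one_pow, mul_one,
        eigenvalues_toeplitzMatrix ha]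
    rw [h1]
    refine abs_integral_le_integral_abs.trans_eq ?_
    simp only [abs_mul, abs_pow, abs_norm]
  calc _ ≤ ∑ k, ∫ s, |a s - c| * ‖inner ℂ (charVec n s) (v k)‖ ^ 2 ∂AddCircle.haarAddCircle :=
        Finset.sum_le_sum fun k _ => hk k
    _ = ∫ s, |a s - c| * n ∂AddCircle.haarAddCircle := by
        rw [← integral_finsetSum _ fun k _ => integrable_mul_norm_inner_charVec_sq hac.abs _]
        simp only [← Finset.mul_sum, v.sum_sq_norm_inner_left, norm_charVec_sq]
    _ = _ := by rw [integral_mul_const, mul_comm]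

theorem fejerMean_eq_inner {b : AddCircle (2 * π) → ℂ} (hb : Integrable b AddCircle.haarAddCircle)
    (t : AddCircle (2 * π)) : fejerMean n b t = (n : ℂ)⁻¹ * inner ℂ (charVec n t)
      (Matrix.toEuclideanLin (toeplitzMatrix b n) (charVec n t)) := by
  rw [fejerMean, inner_toeplitzMatrix hb]

theorem fejerMean_eq_sum {b : AddCircle (2 * π) → ℂ} (hb : Integrable b AddCircle.haarAddCircle)
    (t : AddCircle (2 * π)) : fejerMean n b t = (n : ℂ)⁻¹ *
      ∑ i : Fin n, ∑ j : Fin n, fourierCoeff b ((j : ℤ) - i) * fourier ((j : ℤ) - i) t := by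
  rw [fejerMean_eq_inner hb, inner_charVec]
  congr 1
  refine Finset.sum_congr rfl fun i _ => ?_
  simp only [Matrix.toLpLin_apply, Matrix.mulVec, dotProduct, Finset.sum_mul, charVec]
  refine Finset.sum_congr rfl fun j _ => ?_
  rw [mul_assoc, ← fourier_add]
  rfl

theorem continuous_fejerMean {b : AddCircle (2 * π) → ℂ}
    (hb : Integrable b AddCircle.haarAddCircle) : Continuous (fejerMean n b) := by
  rw [funext (fejerMean_eq_sum hb)]
  fun_prop

theorem integrable_fejerMean {b : AddCircle (2 * π) → ℂ}
    (hb : Integrable b AddCircle.haarAddCircle) :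
    Integrable (fejerMean n b) AddCircle.haarAddCircle :=
  (continuous_fejerMean hb).integrable_of_hasCompactSupport (.of_compactSpace _)

/-- The dual bound: expand the quadratic form at `e_t` in the eigenbasis, where Parseval absorbs
`c`, then integrate in `t`. -/
theorem integral_norm_fejerMean_sub_le (hn : n ≠ 0) (ha : Integrable a AddCircle.haarAddCircle)
    (c : ℝ) : ∫ t, ‖fejerMean n (fun s => (a s : ℂ)) t - c‖ ∂AddCircle.haarAddCircle ≤
      (n : ℝ)⁻¹ * ∑ k, |(toeplitzMatrix_isHermitian a n).eigenvalues k - c| := by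
  have hn' : (n : ℝ) ≠ 0 := Nat.cast_ne_zero.mpr hn
  set v := (toeplitzMatrix_isHermitian a n).eigenvectorBasis
  have haC : Integrable (fun s => (a s : ℂ)) AddCircle.haarAddCircle := ha.ofReal
  have ht (t : AddCircle (2 * π)) : ‖fejerMean n (fun s => (a s : ℂ)) t - c‖ ≤
      (n : ℝ)⁻¹ * ∑ k, |(toeplitzMatrix_isHermitian a n).eigenvalues k - c| *
        ‖inner ℂ (charVec n t) (v k)‖ ^ 2 := by
    have h1 : fejerMean n (fun s => (a s : ℂ)) t - c = (((n : ℝ)⁻¹ *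
        ∑ k, ((toeplitzMatrix_isHermitian a n).eigenvalues k - c) *
          ‖inner ℂ (charVec n t) (v k)‖ ^ 2 : ℝ) : ℂ) := by
      simp only [sub_mul]
      rw [Finset.sum_sub_distrib, ← Finset.mul_sum, v.sum_sq_norm_inner_left, norm_charVec_sq,
        mul_sub, mul_comm c, inv_mul_cancel_left₀ hn', fejerMean_eq_inner haC,
        inner_toEuclideanLin_eq_sum (toeplitzMatrix_isHermitian a n)]
      push_cast
      rfl
    rw [h1, Complex.norm_real, norm_mul, norm_inv, Real.norm_natCast]
    gcongr
    refine (norm_sum_le _ _).trans_eq ?_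
    simp
  have hint (k : Fin n) : Integrable (fun t =>
      |(toeplitzMatrix_isHermitian a n).eigenvalues k - c| *
        ‖inner ℂ (charVec n t) (v k)‖ ^ 2) AddCircle.haarAddCircle :=
    integrable_mul_norm_inner_charVec_sq (integrable_const _) _
  refine (integral_mono ((integrable_fejerMean haC).sub (integrable_const (c : ℂ))).norm
    ((integrable_finsetSum _ fun k _ => hint k).const_mul _) ht).trans_eq ?_
  rw [integral_const_mul, integral_finsetSum _ fun k _ => hint k]
  simp only [integral_const_mul, integral_norm_inner_charVec_sq, OrthonormalBasis.norm_eq_one,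
    one_pow, mul_one]

end Bounds

/-! ### `L¹` convergence of Fejér means -/

theorem norm_fejerMean_le (n : ℕ) (b : AddCircle (2 * π) → ℂ) (t : AddCircle (2 * π)) :
    ‖fejerMean n b t‖ ≤ ‖fejerMean n (fun s => (‖b s‖ : ℂ)) t‖ := by
  simp only [fejerMean, ← Complex.ofReal_mul, integral_complex_ofReal]
  rw [norm_mul, norm_mul, Complex.norm_real,
    Real.norm_of_nonneg (integral_nonneg fun s => by positivity)]
  gcongr
  refine (norm_integral_le_integral_norm _).trans_eq ?_
  simp

/-- Both eigenvalue inequalities, chained for the symbol `‖b‖` with `c = 0`. -/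
theorem integral_norm_fejerMean_le {n : ℕ} (hn : n ≠ 0) {b : AddCircle (2 * π) → ℂ}
    (hb : Integrable b AddCircle.haarAddCircle) :
    ∫ t, ‖fejerMean n b t‖ ∂AddCircle.haarAddCircle ≤ ∫ t, ‖b t‖ ∂AddCircle.haarAddCircle := by
  have hn' : (n : ℝ) ≠ 0 := Nat.cast_ne_zero.mpr hn
  have h1 := integral_norm_fejerMean_sub_le hn hb.norm 0
  have h2 := sum_abs_eigenvalues_sub_le (n := n) hb.norm 0
  simp only [Complex.ofReal_zero, sub_zero, abs_norm] at h1 h2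
  calc _ ≤ _ := integral_mono (integrable_fejerMean hb).norm
        (integrable_fejerMean hb.norm.ofReal).norm (norm_fejerMean_le n b)
    _ ≤ _ := h1
    _ ≤ (n : ℝ)⁻¹ * (n * ∫ t, ‖b t‖ ∂AddCircle.haarAddCircle) := by gcongr
    _ = _ := inv_mul_cancel_left₀ hn' _

theorem fejerMean_congr_ae {b c : AddCircle (2 * π) → ℂ} (h : b =ᵐ[AddCircle.haarAddCircle] c)
    (n : ℕ) : fejerMean n b = fejerMean n c := by
  funext t
  rw [fejerMean, fejerMean]
  congr 1
  refine integral_congr_ae ?_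
  filter_upwards [h] with s hs
  rw [hs]

theorem fejerMean_add {n : ℕ} {b c : AddCircle (2 * π) → ℂ}
    (hb : Integrable b AddCircle.haarAddCircle) (hc : Integrable c AddCircle.haarAddCircle) :
    fejerMean n (b + c) = fejerMean n b + fejerMean n c := by
  funext t
  rw [Pi.add_apply, fejerMean_eq_sum (hb.add hc), fejerMean_eq_sum hb, fejerMean_eq_sum hc,
    fourierCoeff.add hb hc]
  simp only [Pi.add_apply, add_mul, Finset.sum_add_distrib, mul_add]

theorem fejerMean_const_smul (n : ℕ) (z : ℂ) (b : AddCircle (2 * π) → ℂ) :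
    fejerMean n (z • b) = z • fejerMean n b := by
  funext t
  simp only [fejerMean, Pi.smul_apply, smul_eq_mul, mul_assoc, integral_const_mul]
  ring

theorem card_filter_add_not_mem_le (n : ℕ) (m : ℤ) :
    (Finset.univ.filter fun i : Fin n => ¬ (0 ≤ (i : ℤ) + m ∧ (i : ℤ) + m < n)).card ≤
      m.natAbs := by
  have h : (Finset.univ.filter fun i : Fin n => ¬ (0 ≤ (i : ℤ) + m ∧ (i : ℤ) + m < n)).card ≤
      -- One of the two intervals is empty, depending on the sign of `m`.
      (Finset.Ico (n : ℤ) (n + m) ∪ Finset.Ico m 0).card := by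
    refine Finset.card_le_card_of_injOn (fun i => (i : ℤ) + m) (fun i hi => ?_) fun i _ j _ h => ?_
    · have := i.2
      simp at hi ⊢
      omega
    · simpa [Fin.ext_iff] using h
  refine h.trans ((Finset.card_union_le _ _).trans ?_)
  simp only [Int.card_Ico]
  omega

/-- Row `i` of the matrix has its only possible nonzero entry in column `i + m`, so the error comes
from the at most `|m|` rows where that column does not exist. -/
theorem norm_fejerMean_fourier_sub_le {n : ℕ} (hn : n ≠ 0) (m : ℤ) (t : AddCircle (2 * π)) :
    ‖fejerMean n (fourier m) t - fourier m t‖ ≤ (n : ℝ)⁻¹ * m.natAbs := by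
  have hn' : (n : ℂ) ≠ 0 := Nat.cast_ne_zero.mpr hn
  have hint : Integrable (fourier m : AddCircle (2 * π) → ℂ) AddCircle.haarAddCircle :=
    (map_continuous (fourier m)).integrable_of_hasCompactSupport (.of_compactSpace _)
  have hrow (i : Fin n) : ∑ j : Fin n, fourierCoeff (T := 2 * π) (fourier m) ((j : ℤ) - i) *
      fourier ((j : ℤ) - i) t =
        (if 0 ≤ (i : ℤ) + m ∧ (i : ℤ) + m < n then 1 else 0) * fourier m t := by
    rw [fourierCoeff_fourier]
    split_ifs with h
    · rw [Finset.sum_eq_single ⟨((i : ℤ) + m).toNat, by omega⟩]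
      · have : (((((i : ℤ) + m).toNat : ℕ) : ℤ)) - i = m := by omega
        simp only [this, Pi.single_eq_same]
      · intro j _ hj
        rw [Pi.single_eq_of_ne, zero_mul]
        intro hj'
        exact hj (Fin.ext (by simp only []; omega))
      · simp
    · rw [zero_mul]
      refine Finset.sum_eq_zero fun j _ => ?_
      rw [Pi.single_eq_of_ne, zero_mul]
      have := j.2
      omega
  have hsub : fejerMean n (fourier m) t - fourier m t = -((n : ℂ)⁻¹ *
      ((Finset.univ.filter fun i : Fin n => ¬ (0 ≤ (i : ℤ) + m ∧ (i : ℤ) + m < n)).card *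
        fourier m t)) := by
    have hcard := Finset.card_filter_add_card_filter_not (s := (Finset.univ : Finset (Fin n)))
      (fun i => 0 ≤ (i : ℤ) + m ∧ (i : ℤ) + m < n)
    rw [Finset.card_univ, Fintype.card_fin] at hcard
    replace hcard := congrArg (Nat.cast : ℕ → ℂ) hcard
    rw [Nat.cast_add] at hcard
    rw [fejerMean_eq_sum hint, Finset.sum_congr rfl fun i _ => hrow i, ← Finset.sum_mul,
      Finset.sum_boole]
    field_simp
    linear_combination hcard
  rw [hsub, norm_neg, norm_mul, norm_mul, norm_inv, Complex.norm_natCast, Complex.norm_natCast,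
    fourier_apply, Circle.norm_coe, mul_one]
  gcongr
  exact card_filter_add_not_mem_le n m

theorem tendsto_integral_norm_fejerMean_sub_of_mem_span
    {g : Lp ℂ 1 (AddCircle.haarAddCircle (T := 2 * π))}
    (hg : g ∈ Submodule.span ℂ (Set.range (fourierLp (T := 2 * π) 1))) :
    Tendsto (fun n => ∫ t, ‖fejerMean n g t - g t‖ ∂AddCircle.haarAddCircle) atTop (𝓝 0) := by
  have hint (f : Lp ℂ 1 (AddCircle.haarAddCircle (T := 2 * π))) :
      Integrable f AddCircle.haarAddCircle := L1.integrable_coeFn f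
  have hsub (f : Lp ℂ 1 (AddCircle.haarAddCircle (T := 2 * π))) (n : ℕ) :
      Integrable (fun t => fejerMean n f t - f t) AddCircle.haarAddCircle :=
    (integrable_fejerMean (hint f)).sub (hint f)
  induction hg using Submodule.span_induction with
  | mem f hf =>
    obtain ⟨m, rfl⟩ := hf
    have hm := coeFn_fourierLp (T := 2 * π) 1 m
    have hlim : Tendsto (fun n : ℕ => (n : ℝ)⁻¹ * m.natAbs) atTop (𝓝 0) := by
      simpa using (tendsto_inv_atTop_nhds_zero_nat (𝕜 := ℝ)).mul_const (m.natAbs : ℝ)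
    refine squeeze_zero' (Eventually.of_forall fun n => integral_nonneg fun t => norm_nonneg _)
      ?_ hlim
    filter_upwards [eventually_ne_atTop 0] with n hn
    rw [fejerMean_congr_ae hm]
    calc _ ≤ ∫ _, (n : ℝ)⁻¹ * m.natAbs ∂(AddCircle.haarAddCircle (T := 2 * π)) := by
          refine integral_mono_ae ?_ (integrable_const _) ?_
          · rw [← fejerMean_congr_ae hm]
            exact (hsub _ n).norm
          · filter_upwards [hm] with t ht
            rw [ht]
            exact norm_fejerMean_fourier_sub_le hn m t
      _ = _ := by simp
  | zero =>
    have h0 := Lp.coeFn_zero ℂ 1 (AddCircle.haarAddCircle (T := 2 * π))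
    refine tendsto_const_nhds.congr fun n => ?_
    rw [eq_comm, fejerMean_congr_ae h0, integral_eq_zero_of_ae]
    filter_upwards [h0] with t ht
    simp only [fejerMean, Pi.zero_apply, zero_mul, integral_zero, mul_zero, ht, sub_zero, norm_zero]
  | add f h _ _ hf hh =>
    have hadd := Lp.coeFn_add f h
    refine squeeze_zero (fun n => integral_nonneg fun t => norm_nonneg _) (fun n => ?_)
      (by simpa using hf.add hh)
    rw [← integral_add (hsub f n).norm (hsub h n).norm]
    refine integral_mono_ae (hsub _ n).norm ((hsub f n).norm.add (hsub h n).norm) ?_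
    rw [fejerMean_congr_ae hadd, fejerMean_add (hint f) (hint h)]
    filter_upwards [hadd] with t ht
    rw [ht, Pi.add_apply, Pi.add_apply, add_sub_add_comm]
    exact norm_add_le _ _
  | smul z f _ hf =>
    have hz := Lp.coeFn_smul z f
    have hlim := hf.const_mul ‖z‖
    rw [mul_zero] at hlim
    refine hlim.congr fun n => ?_
    rw [← integral_const_mul, fejerMean_congr_ae hz, fejerMean_const_smul]
    refine integral_congr_ae ?_
    filter_upwards [hz] with t ht
    rw [ht, Pi.smul_apply, Pi.smul_apply, ← smul_sub, norm_smul]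

/-- The Fejér means of an integrable function on the circle converge to it in `L¹`. -/
theorem tendsto_integral_norm_fejerMean_sub {b : AddCircle (2 * π) → ℂ}
    (hb : Integrable b AddCircle.haarAddCircle) :
    Tendsto (fun n => ∫ t, ‖fejerMean n b t - b t‖ ∂AddCircle.haarAddCircle) atTop (𝓝 0) := by
  rw [Metric.tendsto_atTop']
  intro ε hε
  have hmem : hb.toL1 b ∈ closure
      (Submodule.span ℂ (Set.range (fourierLp (T := 2 * π) 1)) : Set _) := by
    rw [← Submodule.topologicalClosure_coe, span_fourierLp_closure_eq_top ENNReal.one_ne_top]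
    trivial
  obtain ⟨g, hg, hdist⟩ := Metric.mem_closure_iff.mp hmem (ε / 3) (by positivity)
  have hgi : Integrable g AddCircle.haarAddCircle := L1.integrable_coeFn g
  have hbg : ∫ t, ‖(b - g) t‖ ∂AddCircle.haarAddCircle < ε / 3 := by
    refine lt_of_eq_of_lt ?_ hdist
    rw [L1.dist_eq_integral_dist]
    refine integral_congr_ae ?_
    filter_upwards [hb.coeFn_toL1] with t ht
    rw [ht, dist_eq_norm, Pi.sub_apply]
  -- This form gives a strict `n > N`, hence `n ≠ 0`.
  obtain ⟨N, hN⟩ := Metric.tendsto_atTop'.mp (tendsto_integral_norm_fejerMean_sub_of_mem_span hg)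
    (ε / 3) (by positivity)
  refine ⟨N, fun n hn => ?_⟩
  have hn0 : n ≠ 0 := by omega
  have hNn := hN n hn
  rw [Real.dist_0_eq_abs, abs_of_nonneg (integral_nonneg fun t => norm_nonneg _)] at hNn ⊢
  have hbgi := hb.sub hgi
  have hsplit : fejerMean n b = fejerMean n g + fejerMean n (b - g) := by
    rw [← fejerMean_add hgi hbgi, add_sub_cancel]
  have i1 := (integrable_fejerMean (n := n) hbgi).norm
  have i2 : Integrable (fun t => ‖fejerMean n g t - g t‖) AddCircle.haarAddCircle :=
    ((integrable_fejerMean hgi).sub hgi).norm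
  calc ∫ t, ‖fejerMean n b t - b t‖ ∂AddCircle.haarAddCircle
      ≤ ∫ t, (‖fejerMean n (b - g) t‖ + ‖fejerMean n g t - g t‖ + ‖(b - g) t‖)
          ∂AddCircle.haarAddCircle := by
        refine integral_mono ((integrable_fejerMean hb).sub hb).norm
          ((i1.add i2).add hbgi.norm) fun t => ?_
        have : fejerMean n b t - b t =
            fejerMean n (b - g) t + (fejerMean n g t - g t) - (b - g) t := by
          rw [hsplit, Pi.add_apply, Pi.sub_apply]
          ring
        simp only [this]
        exact (norm_sub_le _ _).trans (by gcongr; exact norm_add_le _ _)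
    _ = (∫ t, ‖fejerMean n (b - g) t‖ ∂AddCircle.haarAddCircle) +
          (∫ t, ‖fejerMean n g t - g t‖ ∂AddCircle.haarAddCircle) +
          ∫ t, ‖(b - g) t‖ ∂AddCircle.haarAddCircle := by
        exact (integral_add (i1.add i2) hbgi.norm).trans
          (congrArg (· + _) (integral_add i1 i2))
    _ < ε := by linarith [integral_norm_fejerMean_le hn0 hbgi]

/-! ### The limit for translated absolute values -/

theorem tendsto_sum_abs_eigenvalues_sub {a : AddCircle (2 * π) → ℝ}
    (ha : Integrable a AddCircle.haarAddCircle) (c : ℝ) :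
    Tendsto (fun n : ℕ => (n : ℝ)⁻¹ * ∑ k, |(toeplitzMatrix_isHermitian a n).eigenvalues k - c|)
      atTop (𝓝 (∫ t, |a t - c| ∂AddCircle.haarAddCircle)) := by
  have haC : Integrable (fun s => (a s : ℂ)) AddCircle.haarAddCircle := ha.ofReal
  have hlow := (tendsto_integral_norm_fejerMean_sub haC).const_sub
    (∫ t, |a t - c| ∂AddCircle.haarAddCircle)
  rw [sub_zero] at hlow
  refine tendsto_of_tendsto_of_tendsto_of_le_of_le' hlow tendsto_const_nhds ?_ ?_
  · filter_upwards [eventually_ne_atTop 0] with n hn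
    refine le_trans ?_ (integral_norm_fejerMean_sub_le hn ha c)
    have i1 := ((integrable_fejerMean (n := n) haC).sub haC).norm
    have i2 := ((integrable_fejerMean (n := n) haC).sub (integrable_const (c : ℂ))).norm
    rw [sub_le_iff_le_add]
    refine (integral_mono (ha.sub (integrable_const c)).abs (i2.add i1) fun t => ?_).trans_eq
      (integral_add i2 i1)
    have h : ((a t - c : ℝ) : ℂ) = (fejerMean n (fun s => (a s : ℂ)) t - c) -
        (fejerMean n (fun s => (a s : ℂ)) t - a t) := by
      push_cast
      ring
    change |a t - c| ≤ _
    rw [← Real.norm_eq_abs, ← Complex.norm_real, h]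
    exact norm_sub_le _ _
  · filter_upwards [eventually_ne_atTop 0] with n hn
    have hn' : (0 : ℝ) < n := Nat.cast_pos.mpr (Nat.pos_of_ne_zero hn)
    rw [inv_mul_le_iff₀ hn']
    exact sum_abs_eigenvalues_sub_le ha c

/-! ### Approximation by tents -/

/-- The piecewise linear tent function `max 0 (1 - |y|)`, as a combination of translates of the
absolute value. -/
noncomputable def tent (y : ℝ) : ℝ := (|y + 1| + |y - 1| - 2 * |y|) / 2

theorem tent_of_one_le_abs {y : ℝ} (hy : 1 ≤ |y|) : tent y = 0 := by
  rw [tent]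
  rcases le_abs'.mp hy with h | h
  · rw [abs_of_nonpos (by linarith), abs_of_nonpos (by linarith), abs_of_nonpos (by linarith)]
    ring
  · rw [abs_of_nonneg (by linarith), abs_of_nonneg (by linarith), abs_of_nonneg (by linarith)]
    ring

theorem tent_of_abs_le_one {y : ℝ} (hy : |y| ≤ 1) : tent y = 1 - |y| := by
  obtain ⟨h1, h2⟩ := abs_le.mp hy
  rw [tent, abs_of_nonneg (by linarith : 0 ≤ y + 1), abs_of_nonpos (by linarith : y - 1 ≤ 0)]
  ring

/-- Only the tents centred at the two integers around `y` can be nonzero there, and their values are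
the linear interpolation weights. Since `f` vanishes off `S`, both nodes may be adjoined to `S`. -/
theorem sum_tent_smul {E : Type*} [AddCommGroup E] [Module ℝ E] (y : ℝ) (f : ℤ → E) (S : Finset ℤ)
    (hf : ∀ j ∉ S, f j = 0) : ∑ j ∈ S, tent (y - j) • f j =
      (1 - Int.fract y) • f ⌊y⌋ + Int.fract y • f (⌊y⌋ + 1) := by
  have h0 := Int.fract_nonneg y
  have h1 := (Int.fract_lt_one y).le
  have hy : y = ⌊y⌋ + Int.fract y := (Int.floor_add_fract y).symm
  have e0 : tent (y - ⌊y⌋) = 1 - Int.fract y := by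
    rw [Int.self_sub_floor, tent_of_abs_le_one (by rwa [abs_of_nonneg h0]), abs_of_nonneg h0]
  have e1 : tent (y - (⌊y⌋ + 1 : ℤ)) = Int.fract y := by
    have : y - (⌊y⌋ + 1 : ℤ) = -(1 - Int.fract y) := by
      rw [Int.cast_add, Int.cast_one]
      linarith
    rw [this, tent_of_abs_le_one] <;> rw [abs_neg, abs_of_nonneg (by linarith)] <;> linarith
  have hne : ⌊y⌋ ≠ ⌊y⌋ + 1 := by omega
  rw [← e0, ← e1, ← Finset.sum_pair (f := fun j : ℤ => tent (y - j) • f j) hne,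
    Finset.sum_subset (Finset.subset_union_left (s₂ := {⌊y⌋, ⌊y⌋ + 1}))
      fun j _ hj => by rw [hf j hj, smul_zero]]
  refine (Finset.sum_subset Finset.subset_union_right fun j _ hj => ?_).symm
  rw [tent_of_one_le_abs, zero_smul]
  simp only [Finset.mem_insert, Finset.mem_singleton, not_or] at hj
  rcases lt_or_gt_of_ne hj.1 with h | h
  · have : (j : ℝ) + 1 ≤ ⌊y⌋ := by exact_mod_cast h
    exact le_abs.mpr (Or.inl (by linarith))
  · have : (⌊y⌋ : ℝ) + 1 + 1 ≤ j := by exact_mod_cast (by omega : ⌊y⌋ + 1 + 1 ≤ j)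
    exact le_abs.mpr (Or.inr (by linarith))

/-- A continuous compactly supported function on the line is a uniform limit of finite
combinations of tent functions. -/
theorem exists_norm_sub_sum_tent_smul_le {E : Type*} [NormedAddCommGroup E] [NormedSpace ℝ E]
    {φ : ℝ → E} (hφ : Continuous φ) (hφc : HasCompactSupport φ) {ε : ℝ} (hε : 0 < ε) :
    ∃ δ > 0, ∃ S : Finset ℤ, ∀ x, ‖φ x - ∑ j ∈ S, tent (x / δ - j) • φ (j * δ)‖ ≤ ε := by
  obtain ⟨η, hη, hunif⟩ := Metric.uniformContinuous_iff.mp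
    (hφc.uniformContinuous_of_continuous hφ) ε hε
  obtain ⟨R, -, hR⟩ := hφc.exists_pos_le_norm
  -- A mesh below `η` keeps `x` within `η` of both neighbouring nodes; `φ` vanishes at the nodes
  -- outside the index range.
  refine ⟨η / 2, half_pos hη, Finset.Icc (-⌈R / (η / 2)⌉) ⌈R / (η / 2)⌉, fun x => ?_⟩
  set δ := η / 2 with hδ
  have hδ0 : 0 < δ := half_pos hη
  rw [sum_tent_smul (x / δ) (fun j : ℤ => φ (j * δ))]
  · set m := ⌊x / δ⌋
    set θ := Int.fract (x / δ)
    have h0 : 0 ≤ θ := Int.fract_nonneg _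
    have h1 : θ < 1 := Int.fract_lt_one _
    have hx : x = m * δ + θ * δ := by
      rw [← add_mul, Int.floor_add_fract, div_mul_cancel₀ _ hδ0.ne']
    have d0 : ‖φ x - φ (m * δ)‖ ≤ ε := by
      rw [← dist_eq_norm]
      refine (hunif ?_).le
      rw [Real.dist_eq, hx, add_sub_cancel_left, abs_of_nonneg (by positivity)]
      nlinarith
    have d1 : ‖φ x - φ ((m + 1 : ℤ) * δ)‖ ≤ ε := by
      rw [← dist_eq_norm]
      refine (hunif ?_).le
      have : x - (m + 1 : ℤ) * δ = -((1 - θ) * δ) := by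
        push_cast
        linear_combination hx
      rw [Real.dist_eq, this, abs_neg, abs_of_nonneg (mul_nonneg (by linarith) hδ0.le)]
      nlinarith
    have hcomb : φ x - ((1 - θ) • φ (m * δ) + θ • φ ((m + 1 : ℤ) * δ)) =
        (1 - θ) • (φ x - φ (m * δ)) + θ • (φ x - φ ((m + 1 : ℤ) * δ)) := by
      module
    rw [hcomb]
    refine (norm_add_le _ _).trans ?_
    rw [norm_smul, norm_smul, Real.norm_of_nonneg h0, Real.norm_of_nonneg (by linarith)]
    nlinarith
  · intro j hj
    refine hR _ ?_
    rw [Real.norm_eq_abs, abs_mul, abs_of_pos hδ0, ← div_le_iff₀ hδ0]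
    refine (Int.le_ceil _).trans ?_
    rw [← Int.cast_abs, Int.cast_le]
    rw [Finset.mem_Icc, ← abs_le] at hj
    omega

/-! ### Passage to general test functions -/

section Limit

variable {a : AddCircle (2 * π) → ℝ}

theorem tent_div_sub {δ : ℝ} (hδ : 0 < δ) (c x : ℝ) : tent (x / δ - c) =
    (2 * δ)⁻¹ * (|x - (c - 1) * δ| + |x - (c + 1) * δ| - 2 * |x - c * δ|) := by
  have h (d : ℝ) : |x - d * δ| = δ * |x / δ - d| := by
    rw [← abs_of_pos hδ, ← abs_mul, abs_of_pos hδ, mul_sub, mul_div_cancel₀ _ hδ.ne', mul_comm d]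
  rw [tent, h, h, h, sub_add, sub_sub]
  field_simp

theorem integrable_tent_comp (ha : Integrable a AddCircle.haarAddCircle) {δ : ℝ} (hδ : 0 < δ)
    (c : ℝ) : Integrable (fun t => tent (a t / δ - c)) AddCircle.haarAddCircle := by
  have h (d : ℝ) : Integrable (fun t => |a t - d|) AddCircle.haarAddCircle :=
    (ha.sub (integrable_const d)).abs
  simp only [tent_div_sub hδ]
  exact (((h _).add (h _)).sub ((h _).const_mul 2)).const_mul _

theorem tendsto_sum_tent_eigenvalues (ha : Integrable a AddCircle.haarAddCircle) {δ : ℝ}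
    (hδ : 0 < δ) (c : ℝ) : Tendsto
      (fun n : ℕ =>
        (n : ℝ)⁻¹ * ∑ k, tent ((toeplitzMatrix_isHermitian a n).eigenvalues k / δ - c))
      atTop (𝓝 (∫ t, tent (a t / δ - c) ∂AddCircle.haarAddCircle)) := by
  have h (d : ℝ) : Integrable (fun t => |a t - d|) AddCircle.haarAddCircle :=
    (ha.sub (integrable_const d)).abs
  have hL := tendsto_sum_abs_eigenvalues_sub ha
  simp only [tent_div_sub hδ]
  have hadd (d e : ℝ) : Integrable (fun t => |a t - d| + |a t - e|) AddCircle.haarAddCircle :=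
    (h d).add (h e)
  rw [integral_const_mul, integral_sub (hadd _ _) ((h _).const_mul 2),
    integral_add (h _) (h _), integral_const_mul]
  refine ((((hL _).add (hL _)).sub ((hL _).const_mul 2)).const_mul _).congr fun n => ?_
  rw [← Finset.mul_sum, Finset.sum_sub_distrib, Finset.sum_add_distrib, ← Finset.mul_sum]
  ring

theorem tendsto_sum_eigenvalues_toeplitzMatrix {𝕜 : Type*} [RCLike 𝕜]
    (ha : Integrable a AddCircle.haarAddCircle) {φ : ℝ → 𝕜} (hφ : Continuous φ)
    (hφc : HasCompactSupport φ) : Tendsto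
      (fun n : ℕ => (n : ℝ)⁻¹ • ∑ k, φ ((toeplitzMatrix_isHermitian a n).eigenvalues k))
      atTop (𝓝 (∫ t, φ (a t) ∂AddCircle.haarAddCircle)) := by
  rw [Metric.tendsto_atTop']
  intro ε hε
  -- The error `ε / 4` is paid twice, for the eigenvalue mean and for the integral.
  obtain ⟨δ, hδ, S, hS⟩ := exists_norm_sub_sum_tent_smul_le hφ hφc (half_pos (half_pos hε))
  set ψ : ℝ → 𝕜 := fun x => ∑ j ∈ S, tent (x / δ - j) • φ (j * δ) with hψ
  have hψi (j : ℤ) :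
      Integrable (fun t => tent (a t / δ - j) • φ (j * δ)) AddCircle.haarAddCircle :=
    (integrable_tent_comp ha hδ j).smul_const _
  have hlim : Tendsto
      (fun n : ℕ => (n : ℝ)⁻¹ • ∑ k, ψ ((toeplitzMatrix_isHermitian a n).eigenvalues k))
      atTop (𝓝 (∫ t, ψ (a t) ∂AddCircle.haarAddCircle)) := by
    rw [integral_finsetSum _ fun j _ => hψi j]
    simp only [integral_smul_const]
    refine (tendsto_finsetSum S fun j _ =>
      (tendsto_sum_tent_eigenvalues ha hδ j).smul_const (φ (j * δ))).congr fun n => ?_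
    rw [Finset.sum_comm, Finset.smul_sum]
    refine Finset.sum_congr rfl fun j _ => ?_
    rw [← Finset.sum_smul, smul_smul]
  have hφi : Integrable (fun t => φ (a t)) AddCircle.haarAddCircle := by
    obtain ⟨C, hC⟩ := hφ.bounded_above_of_compact_support hφc
    exact .of_bound (hφ.comp_aestronglyMeasurable ha.1) C (ae_of_all _ fun t => hC _)
  have hint : ‖(∫ t, φ (a t) ∂AddCircle.haarAddCircle) - ∫ t, ψ (a t) ∂AddCircle.haarAddCircle‖ ≤
      ε / 2 / 2 := by
    rw [← integral_sub hφi (integrable_finsetSum _ fun j _ => hψi j)]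
    simpa using norm_integral_le_of_norm_le_const (μ := AddCircle.haarAddCircle (T := 2 * π))
      (ae_of_all _ fun t => hS (a t))
  obtain ⟨N, hN⟩ := Metric.tendsto_atTop'.mp hlim (ε / 2) (half_pos hε)
  refine ⟨N, fun n hn => ?_⟩
  have hn' : (n : ℝ) ≠ 0 := Nat.cast_ne_zero.mpr (by omega)
  have hsum : ‖(n : ℝ)⁻¹ • ∑ k, φ ((toeplitzMatrix_isHermitian a n).eigenvalues k) -
      (n : ℝ)⁻¹ • ∑ k, ψ ((toeplitzMatrix_isHermitian a n).eigenvalues k)‖ ≤ ε / 2 / 2 := by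
    rw [← smul_sub, ← Finset.sum_sub_distrib, norm_smul, norm_inv, Real.norm_natCast]
    calc _ ≤ (n : ℝ)⁻¹ * ∑ _k : Fin n, ε / 2 / 2 := by
          gcongr
          exact (norm_sum_le _ _).trans (Finset.sum_le_sum fun k _ => hS _)
      _ = _ := by simp [hn']
  have hNn := hN n hn
  rw [dist_eq_norm] at hNn ⊢
  have htri := norm_add₃_le
    (a := (n : ℝ)⁻¹ • ∑ k, φ ((toeplitzMatrix_isHermitian a n).eigenvalues k) -
      (n : ℝ)⁻¹ • ∑ k, ψ ((toeplitzMatrix_isHermitian a n).eigenvalues k))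
    (b := (n : ℝ)⁻¹ • ∑ k, ψ ((toeplitzMatrix_isHermitian a n).eigenvalues k) -
      ∫ t, ψ (a t) ∂AddCircle.haarAddCircle)
    (c := (∫ t, ψ (a t) ∂AddCircle.haarAddCircle) - ∫ t, φ (a t) ∂AddCircle.haarAddCircle)
  rw [sub_add_sub_cancel, sub_add_sub_cancel,
    norm_sub_rev (∫ t, ψ (a t) ∂AddCircle.haarAddCircle)] at htri
  linarith

end Limit

theorem mainTheorem4 {𝕜 : Type*} [RCLike 𝕜]
    (a : AddCircle (2 * π) → ℝ) (ha : Integrable a)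
    (φ : ℝ → 𝕜) (hφ : Continuous φ) (hφc : HasCompactSupport φ) :
    Tendsto
      (fun n : ℕ =>
        (1 / (n : ℝ)) • ∑ k : Fin n, φ ((toeplitzMatrix_isHermitian a n).eigenvalues k))
      atTop
      (𝓝 ((1 / (2 * π)) • ∫ t in (-π)..π, φ (a (t : AddCircle (2 * π))))) := by
  have ha' : Integrable a AddCircle.haarAddCircle := by
    -- The volume has mass `2π`, the Haar measure mass 1.
    rw [AddCircle.volume_eq_smul_haarAddCircle] at ha
    exact (integrable_smul_measure (by simpa using Real.pi_pos) ENNReal.ofReal_ne_top).mp ha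
  have hper := AddCircle.intervalIntegral_preimage (2 * π) (-π) fun t => φ (a t)
  rw [show -π + 2 * π = π by ring] at hper
  simp only [one_div]
  rw [hper, ← AddCircle.integral_haarAddCircle]
  exact tendsto_sum_eigenvalues_toeplitzMatrix ha' hφ hφc
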